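/- Work over $\mathbb{C}$ and let $\mathbb{C}[\boldsymbol{x}]_d$ be the space of homogeneous polynomials of degree $d$ in $\boldsymbol{x}=(x_1,\dots,x_n)$. For $f\in\mathbb{C}[\boldsymbol{x}]_d$ with $d\ge 1$, the Waring rank $\mathsf{WR}(f)$ is the least $s$ such that $f=\sum_{k=1}^{s}\ell_k^d$ for some linear forms $\ell_1,\dots,\ell_s\in\mathbb{C}[\boldsymbol{x}]_1$, and the border Waring rank $\underline{\mathsf{WR}}(f)$ is the least $s$ such that $f=\lim_{\epsilon\to 0}\sum_{k=1}^{s}\ell_k^d$ (coefficientwise limit) for some linear forms $\ell_1,\dots,\ell_s\in\mathbb{C}(\epsilon)[\boldsymbol{x}]_1$ whose coefficients are rational functions of $\epsilon$. In degree $0$ the summands are arbitrary constants, so that a nonzero constant has Waring rank $1$; the zero polynomial has Waring rank $0$. Let \[ \mathsf{maxR}(n,e)=\max\{\mathsf{WR}(g)\mid g\in\mathbb{C}[x_1,\dots,x_n]_e\},\qquad M(r)=\max_{r_1+\dots+r_m=r}\ \sum_{k=1}^{m}\mathsf{maxR}(r_k,r_k-1), \] where the second maximum is over all partitions of $r$ into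 positive integers $r_1,\dots,r_m$ (so $M(0)=0$). **Theorem.** Let $d\ge 1$ and let $f\in\mathbb{C}[\boldsymbol{x}]_d$ have border Waring rank $\underline{\mathsf{WR}}(f)=r$. Then $M(r)$ is finite and \[ \mathsf{WR}(f)\le M(r)\cdot d . \] -/

import Mathlib

open Filter Topology

namespace Waring

noncomputable section

/-- The possible summands of a Waring decomposition in degree `d` over a field `K`: the `d`-th
powers `ℓ ^ d` of linear forms `ℓ` in `x₁, …, xₙ`. In degree `0` the summands are the constants
(scalar multiples of `1 = ℓ ^ 0`), so that powers of linear forms span the forms of degree `0` and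
a nonzero constant has Waring rank `1`. -/
def IsSummand {K : Type*} [Field K] {n : ℕ} (d : ℕ) (p : MvPolynomial (Fin n) K) : Prop :=
  (1 ≤ d ∧ ∃ ℓ : MvPolynomial (Fin n) K, ℓ.IsHomogeneous 1 ∧ p = ℓ ^ d) ∨
    (d = 0 ∧ p.IsHomogeneous 0)

/-- `f` is a sum of `r` summands of degree `d`. -/
def HasDecomposition {n : ℕ} (d : ℕ) (f : MvPolynomial (Fin n) ℂ) (r : ℕ) : Prop :=
  ∃ p : Fin r → MvPolynomial (Fin n) ℂ, (∀ k, IsSummand d (p k)) ∧ f = ∑ k, p k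

/-- The Waring rank `WR(f)` of a form `f` of degree `d`: the least number of summands in a Waring
rank decomposition (`⊤` if there were none). -/
def waringRank {n : ℕ} (d : ℕ) (f : MvPolynomial (Fin n) ℂ) : ℕ∞ :=
  ⨅ (r : ℕ) (_ : HasDecomposition d f r), (r : ℕ∞)

/-- `lim_{ε → 0} g = f` for a polynomial `g` with coefficients in `ℂ(ε)`: each coefficient of `g`,
as a function of a complex number `ε ≠ 0`, tends to the corresponding coefficient of `f`. -/
def HasLimit {n : ℕ} (g : MvPolynomial (Fin n) (RatFunc ℂ)) (f : MvPolynomial (Fin n) ℂ) : Prop :=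
  ∀ m : Fin n →₀ ℕ,
    Tendsto (fun ε : ℂ => RatFunc.eval (RingHom.id ℂ) ε (g.coeff m)) (𝓝[≠] 0) (𝓝 (f.coeff m))

/-- `f = lim_{ε → 0}` of a sum of `r` summands of degree `d` with coefficients in `ℂ(ε)`. -/
def HasBorderDecomposition {n : ℕ} (d : ℕ) (f : MvPolynomial (Fin n) ℂ) (r : ℕ) : Prop :=
  ∃ p : Fin r → MvPolynomial (Fin n) (RatFunc ℂ),
    (∀ k, IsSummand d (p k)) ∧ HasLimit (∑ k, p k) f

/-- The border Waring rank of a form `f` of degree `d`. -/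
def borderWaringRank {n : ℕ} (d : ℕ) (f : MvPolynomial (Fin n) ℂ) : ℕ∞ :=
  ⨅ (r : ℕ) (_ : HasBorderDecomposition d f r), (r : ℕ∞)

/-- `maxR(n, d)`, the maximum Waring rank of forms of degree `d` in `n` variables. -/
def maxR (n d : ℕ) : ℕ∞ :=
  ⨆ (f : MvPolynomial (Fin n) ℂ) (_ : f.IsHomogeneous d), waringRank d f

/-- The partition-maxrank function: the maximum over partitions `r = r₁ + ⋯ + rₘ` into positive
parts of `∑ₖ maxR(rₖ, rₖ - 1)`. -/
def partitionMaxR (r : ℕ) : ℕ∞ :=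
  ⨆ P : Nat.Partition r, (P.parts.map fun s => maxR s (s - 1)).sum

end

end Waring

/-!
A border Waring decomposition of `f` is, after clearing denominators, an identity
`∑ₖ cₖ Lₖ ^ d = ε ^ m F` over `ℂ[ε]`, with linear forms `Lₖ` that do not vanish at `ε = 0` and with
`F(0) = f` (`exists_polynomial_decomposition`).

Suppose first that `r ≤ d + 1`, and group the `Lₖ` according to the point of projective space given
by `Lₖ(0)`. Two facts, both proved by differentiating along a direction that annihilates one of the
forms, control the groups. If all `Lₖ(0)` in a group of `s` forms are proportional to `ℓ`, then the
leading term in `ε` of the sum over this group is divisible by `ℓ ^ (d + 1 - s)`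
(`linForm_pow_dvd_leading_term`): the derivative along a direction killed by one `Lₖ` has one
summand fewer and one degree less. Moreover multiples of such powers of pairwise non-proportional
forms are linearly independent (`eq_zero_of_sum_eq_zero`). Hence negative powers of `ε` cannot
cancel between different groups, each group converges by itself (`exists_class_sums`), and
`f = ∑ ℓ ^ (d + 1 - s) g` with `deg g = s - 1`.

The common kernel of the `s` forms of a group has a limit of codimension at most `s`
(`le_finrank_limitKernel`), and `g` is invariant under translations along it, so `g` is a form in
`s` variables and has Waring rank at most `maxR s (s - 1)`. Since `ℓᵃ mᵇ` has Waring rank at most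
`a + b` (`waringRank_pow_mul_pow_le`), the group contributes at most `maxR s (s - 1) * d`.

If `r > d + 1`, translation invariance alone shows that `f` can be written in `r` variables, and
`maxR r d ≤ maxR r (r - 1)` because every form is a derivative of a form of higher degree
(`maxR_mono_right`). The bound on `ℓᵃ mᵇ` together with Euler's identity also gives the finiteness
of `maxR` (`maxR_lt_top`).
-/

namespace Waring

open MvPolynomial

/-! ### Linear forms and directional derivatives -/

/-- The linear form `∑ᵢ aᵢ xᵢ` with coefficient vector `a`. -/
noncomputable def linForm {R : Type*} [CommRing R] {n : ℕ} (a : Fin n → R) :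
    MvPolynomial (Fin n) R :=
  ∑ i, C (a i) * X i

/-- The derivative `∑ᵢ vᵢ ∂/∂xᵢ` in the direction of the constant vector `v`. -/
noncomputable def dirDeriv {R : Type*} [CommRing R] {n : ℕ} (v : Fin n → R) :
    Derivation R (MvPolynomial (Fin n) R) (MvPolynomial (Fin n) R) :=
  ∑ i, v i • pderiv i

section

variable {R S : Type*} [CommRing R] [CommRing S] {n : ℕ}

theorem linForm_isHomogeneous (a : Fin n → R) : (linForm a).IsHomogeneous 1 :=
  IsHomogeneous.sum _ _ _ fun i _ => isHomogeneous_C_mul_X (a i) i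

theorem coeff_linForm (a : Fin n → R) (i : Fin n) :
    (linForm a).coeff (Finsupp.single i 1) = a i := by
  simp [linForm, coeff_sum, coeff_C_mul, coeff_X, Finsupp.single_left_inj]

theorem exists_eq_linForm {p : MvPolynomial (Fin n) R} (hp : p.IsHomogeneous 1) :
    ∃ a : Fin n → R, p = linForm a := by
  rw [← mem_homogeneousSubmodule, homogeneousSubmodule_one_eq_span_X,
    Submodule.mem_span_range_iff_exists_fun] at hp
  obtain ⟨a, rfl⟩ := hp
  exact ⟨a, by simp [linForm, smul_eq_C_mul]⟩

theorem linForm_smul (c : R) (a : Fin n → R) : linForm (c • a) = C c * linForm a := by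
  simp [linForm, Finset.mul_sum, mul_assoc]

theorem linForm_ne_zero {a : Fin n → R} (ha : a ≠ 0) : linForm a ≠ 0 := by
  intro h
  apply ha
  funext i
  rw [← coeff_linForm a i, h, coeff_zero, Pi.zero_apply]

theorem map_linForm (φ : R →+* S) (a : Fin n → R) :
    map φ (linForm a) = linForm (φ ∘ a) := by
  simp [linForm]

theorem eval_linForm (a x : Fin n → R) : eval x (linForm a) = a ⬝ᵥ x := by
  simp [linForm, dotProduct]

theorem dirDeriv_apply (v : Fin n → R) (p : MvPolynomial (Fin n) R) :
    dirDeriv v p = ∑ i, v i • pderiv i p := by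
  rw [dirDeriv, ← Derivation.coeFnAddMonoidHom_apply, map_sum, Finset.sum_apply]
  rfl

theorem dirDeriv_add (v w : Fin n → R) (p : MvPolynomial (Fin n) R) :
    dirDeriv (v + w) p = dirDeriv v p + dirDeriv w p := by
  simp [dirDeriv_apply, add_smul, Finset.sum_add_distrib]

theorem dirDeriv_smul (c : R) (v : Fin n → R) (p : MvPolynomial (Fin n) R) :
    dirDeriv (c • v) p = c • dirDeriv v p := by
  simp [dirDeriv_apply, mul_smul, Finset.smul_sum]

theorem dirDeriv_single (i : Fin n) (p : MvPolynomial (Fin n) R) :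
    dirDeriv (Pi.single i 1) p = pderiv i p := by
  rw [dirDeriv_apply, Finset.sum_eq_single i] <;> simp +contextual

theorem dirDeriv_linForm (v a : Fin n → R) : dirDeriv v (linForm a) = C (a ⬝ᵥ v) := by
  have h : ∀ i, pderiv i (linForm a) = C (a i) := fun i => by
    simp [linForm, pderiv_X, Pi.single_apply]
  simp [dirDeriv_apply, h, dotProduct, smul_eq_C_mul, mul_comm]

theorem dirDeriv_C_mul (v : Fin n → R) (c : R) (p : MvPolynomial (Fin n) R) :
    dirDeriv v (C c * p) = C c * dirDeriv v p := by
  rw [← smul_eq_C_mul, ← smul_eq_C_mul, Derivation.map_smul]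

theorem dirDeriv_linForm_pow (v a : Fin n → R) (d : ℕ) :
    dirDeriv v (linForm a ^ d) = C ((d : R) * (a ⬝ᵥ v)) * linForm a ^ (d - 1) := by
  rw [Derivation.leibniz_pow, dirDeriv_linForm]
  simp only [smul_eq_mul, nsmul_eq_mul, map_mul, map_natCast]
  ring

theorem dirDeriv_comm (v w : Fin n → R) (p : MvPolynomial (Fin n) R) :
    dirDeriv v (dirDeriv w p) = dirDeriv w (dirDeriv v p) := by
  have h : ⁅dirDeriv v, dirDeriv w⁆ = 0 := by
    apply MvPolynomial.derivation_ext
    intro i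
    have hX : (X i : MvPolynomial (Fin n) R) = linForm (Pi.single i 1) := by
      rw [linForm, Finset.sum_eq_single i] <;> simp +contextual
    simp [Derivation.commutator_apply, hX, dirDeriv_linForm]
  have := congrArg (fun D => D p) h
  simpa [Derivation.commutator_apply, sub_eq_zero] using this

theorem isHomogeneous_dirDeriv {p : MvPolynomial (Fin n) R} {d : ℕ} (hp : p.IsHomogeneous d)
    (v : Fin n → R) : (dirDeriv v p).IsHomogeneous (d - 1) := by
  rw [dirDeriv_apply]
  refine IsHomogeneous.sum _ _ _ fun i _ => ?_
  rw [smul_eq_C_mul]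
  exact hp.pderiv.C_mul _

theorem map_dirDeriv (φ : R →+* S) (v : Fin n → R) (p : MvPolynomial (Fin n) R) :
    map φ (dirDeriv v p) = dirDeriv (φ ∘ v) (map φ p) := by
  simp [dirDeriv_apply, smul_eq_C_mul, pderiv_map]

/-- A derivation lowers the exponent of a divisor that is a power by at most one. -/
theorem pow_dvd_dirDeriv {q p : MvPolynomial (Fin n) R} {e : ℕ} (v : Fin n → R) (h : q ^ e ∣ p) :
    q ^ (e - 1) ∣ dirDeriv v p := by
  obtain ⟨g, rfl⟩ := h
  rw [Derivation.leibniz, Derivation.leibniz_pow]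
  simp only [smul_eq_mul, nsmul_eq_mul]
  refine dvd_add (((pow_dvd_pow q (Nat.sub_le e 1)).mul_right _)) ?_
  exact Dvd.intro _ (by ring : q ^ (e - 1) * (g * e * dirDeriv v q) = _)

/-- The homogeneous part of a cofactor of a homogeneous divisor is again a cofactor. -/
theorem exists_homogeneous_cofactor {q p : MvPolynomial (Fin n) R} {a d : ℕ}
    (hq : q.IsHomogeneous a) (hp : p.IsHomogeneous d) (had : a ≤ d) (h : q ∣ p) :
    ∃ g : MvPolynomial (Fin n) R, g.IsHomogeneous (d - a) ∧ p = q * g := by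
  obtain ⟨g, rfl⟩ := h
  refine ⟨homogeneousComponent (d - a) g, homogeneousComponent_isHomogeneous _ _, ?_⟩
  let _ : GradedAlgebra (homogeneousSubmodule (Fin n) R) := MvPolynomial.gradedAlgebra
  have h := DirectSum.coe_decompose_mul_of_left_mem_of_le (homogeneousSubmodule (Fin n) R)
    (b := g) ((mem_homogeneousSubmodule a q).2 hq) had
  have h2 : ∀ (i : ℕ) (p : MvPolynomial (Fin n) R),
      (DirectSum.decompose (homogeneousSubmodule (Fin n) R) p i : MvPolynomial (Fin n) R)
        = homogeneousComponent i p := fun i p => decomposition.decompose'_apply p i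
  rw [h2, h2, homogeneousComponent_eq_self hp] at h
  exact h

theorem isHomogeneous_of_C_mul [IsDomain R] {c : R} (hc : c ≠ 0) {p : MvPolynomial (Fin n) R}
    {d : ℕ} (h : (C c * p).IsHomogeneous d) : p.IsHomogeneous d := by
  intro m hm
  apply h
  rw [coeff_C_mul]
  exact mul_ne_zero hc hm

end

section Field

variable {n : ℕ}

theorem eq_zero_of_dirDeriv_eq_zero {p : MvPolynomial (Fin n) ℂ} {d : ℕ} (hd : d ≠ 0)
    (hp : p.IsHomogeneous d) (h : ∀ v, dirDeriv v p = 0) : p = 0 := by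
  have hE := hp.sum_X_mul_pderiv
  simp only [← dirDeriv_single, h, mul_zero, Finset.sum_const_zero] at hE
  simpa [hd] using hE.symm

theorem exists_dotProduct_eq_one {l : Fin n → ℂ} (hl : l ≠ 0) : ∃ w : Fin n → ℂ, l ⬝ᵥ w = 1 := by
  obtain ⟨i, hi⟩ := Function.ne_iff.1 hl
  exact ⟨Pi.single i (l i)⁻¹, by simpa using mul_inv_cancel₀ hi⟩

/-- A form of degree `d ≥ e` is divisible by `ℓ ^ e` as soon as all of its derivatives along the
hyperplane `ℓ = 0` are. Euler's identity writes `d • p` as a combination of such derivatives plus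
`ℓ` times a transversal derivative, which is treated by induction on `e`. -/
theorem linForm_pow_dvd_of_dirDeriv {l : Fin n → ℂ} (hl : l ≠ 0) {e : ℕ} :
    ∀ {d : ℕ} {p : MvPolynomial (Fin n) ℂ}, p.IsHomogeneous d → e ≤ d →
      (∀ v, l ⬝ᵥ v = 0 → linForm l ^ e ∣ dirDeriv v p) → linForm l ^ e ∣ p := by
  obtain ⟨w, hw⟩ := exists_dotProduct_eq_one hl
  induction e with
  | zero => intro d p _ _ _; simp
  | succ e ih =>
    intro d p hp hed h
    have hwd : linForm l ^ e ∣ dirDeriv w p := by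
      refine ih (isHomogeneous_dirDeriv hp w) (by omega) fun v hv => ?_
      rw [dirDeriv_comm]
      have := pow_dvd_dirDeriv w (h v hv)
      rwa [Nat.add_sub_cancel] at this
    have hE := hp.sum_X_mul_pderiv
    have hi : ∀ i : Fin n, pderiv i p
        = dirDeriv (Pi.single i 1 - l i • w) p + C (l i) * dirDeriv w p := fun i => by
      rw [← dirDeriv_single, ← smul_eq_C_mul, ← dirDeriv_smul, ← dirDeriv_add, sub_add_cancel]
    have hdvd : linForm l ^ (e + 1) ∣ ∑ i : Fin n, X i * pderiv i p := by
      simp only [hi, mul_add, Finset.sum_add_distrib]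
      refine dvd_add (Finset.dvd_sum fun i _ => (h _ ?_).mul_left _) ?_
      · simp [dotProduct_sub, dotProduct_smul, hw]
      · have : ∑ i : Fin n, X i * (C (l i) * dirDeriv w p) = linForm l * dirDeriv w p := by
          rw [linForm, Finset.sum_mul]
          exact Finset.sum_congr rfl fun i _ => by ring
        rw [this, pow_succ']
        exact mul_dvd_mul_left _ hwd
    rw [hE] at hdvd
    have hp' : p = C (d : ℂ)⁻¹ * (d • p) := by
      have hd : (d : ℂ) ≠ 0 := by exact_mod_cast (by omega : d ≠ 0)
      rw [nsmul_eq_mul, ← map_natCast (C : ℂ →+* MvPolynomial (Fin n) ℂ), ← mul_assoc, ← map_mul,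
        inv_mul_cancel₀ hd, map_one, one_mul]
    rw [hp']
    exact hdvd.mul_left _

end Field

/-! ### Leading terms of sums of powers over `ℂ[ε]` -/

section

variable {n : ℕ}

/-- If the forms `L k`, `k ∈ s`, all specialise at `ε = 0` to multiples of one linear form `ℓ`,
then the leading term in `ε` of a combination of their `d`-th powers is divisible by
`ℓ ^ (d + 1 - #s)`. The derivative along a direction killed by one of the `L k` removes that
summand, so the claim follows by induction on `#s` from `linForm_pow_dvd_of_dirDeriv`. -/
theorem linForm_pow_dvd_leading_term {ι : Type*} {l : Fin n → ℂ} (hl : l ≠ 0)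
    (L : ι → Fin n → Polynomial ℂ) (m : ℕ) (s : Finset ι)
    (hL : ∀ k ∈ s, ∃ a : ℂ, a ≠ 0 ∧ Polynomial.constantCoeff ∘ L k = a • l) {d : ℕ}
    {c : ι → Polynomial ℂ} {F : MvPolynomial (Fin n) (Polynomial ℂ)} (hF : F.IsHomogeneous d)
    (h : ∑ k ∈ s, C (c k) * linForm (L k) ^ d = C (Polynomial.X ^ m) * F) :
    linForm l ^ (d + 1 - s.card) ∣ map Polynomial.constantCoeff F := by
  classical
  have hX : (Polynomial.X ^ m : Polynomial ℂ) ≠ 0 := pow_ne_zero _ Polynomial.X_ne_zero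
  induction s using Finset.induction_on generalizing d c F with
  | empty =>
    rw [Finset.sum_empty, eq_comm, mul_eq_zero, C_eq_zero] at h
    rw [h.resolve_left hX, map_zero]
    exact dvd_zero _
  | insert k s hk ih =>
    rw [Finset.card_insert_of_notMem hk]
    rcases d with _ | d
    · simp
    obtain ⟨w, hw⟩ := exists_dotProduct_eq_one hl
    obtain ⟨a, ha, hka⟩ := hL k (Finset.mem_insert_self k s)
    have hF0 := hF.map Polynomial.constantCoeff
    refine linForm_pow_dvd_of_dirDeriv hl hF0 (by omega) fun v₀ hv₀ => ?_
    -- `L k` vanishes at `v`, and at `ε = 0` the vector `v` is a nonzero multiple of `v₀`.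
    set v := (L k ⬝ᵥ Polynomial.C ∘ w) • (Polynomial.C ∘ v₀)
      - (L k ⬝ᵥ Polynomial.C ∘ v₀) • (Polynomial.C ∘ w) with hv
    have hcC : ∀ u : Fin n → ℂ, Polynomial.constantCoeff ∘ (Polynomial.C ∘ u) = u := fun u => by
      ext i; simp
    have hdot : ∀ u : Fin n → ℂ,
        Polynomial.constantCoeff (L k ⬝ᵥ Polynomial.C ∘ u) = a * (l ⬝ᵥ u) := fun u => by
      rw [RingHom.map_dotProduct, hcC, hka, smul_dotProduct, smul_eq_mul]
    have hkv : L k ⬝ᵥ v = 0 := by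
      rw [hv, dotProduct_sub, dotProduct_smul, dotProduct_smul, smul_eq_mul, smul_eq_mul]
      ring
    have hv0 : Polynomial.constantCoeff ∘ v = a • v₀ := by
      have h1 := hdot w
      have h2 := hdot v₀
      rw [hw, mul_one] at h1
      rw [hv₀, mul_zero] at h2
      ext i
      simp only [hv, Function.comp_apply, Pi.sub_apply, Pi.smul_apply, smul_eq_mul, map_sub,
        map_mul, h1, h2]
      simp
    have hD := congrArg (dirDeriv v) h
    rw [Finset.sum_insert hk, map_add, map_sum, dirDeriv_C_mul, dirDeriv_C_mul,
      dirDeriv_linForm_pow, hkv, mul_zero, map_zero, zero_mul, mul_zero, zero_add] at hD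
    have := ih (fun j hj => hL j (Finset.mem_insert_of_mem hj))
      (c := fun j => c j * (((d + 1 : ℕ) : Polynomial ℂ) * (L j ⬝ᵥ v)))
      (isHomogeneous_dirDeriv hF v) (by
        rw [← hD]
        refine Finset.sum_congr rfl fun j _ => ?_
        rw [dirDeriv_C_mul, dirDeriv_linForm_pow, map_mul C, mul_assoc])
    rw [map_dirDeriv, hv0, dirDeriv_smul] at this
    have h3 : dirDeriv v₀ (map Polynomial.constantCoeff F)
        = C a⁻¹ * (a • dirDeriv v₀ (map Polynomial.constantCoeff F)) := by
      rw [smul_eq_C_mul, ← mul_assoc, ← map_mul, inv_mul_cancel₀ ha, map_one, one_mul]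
    rw [h3]
    refine Dvd.dvd.mul_left ?_ _
    convert this using 2
    omega

/-- Multiples of sufficiently high powers of pairwise non-proportional linear forms are linearly
independent: this generalises the independence of `d + 1` powers `ℓᵢ ^ d`, and allows each `ℓᵢ` to
occur with a multiplicity `s i`. -/
theorem eq_zero_of_sum_eq_zero {ι : Type*} (T : Finset ι) {l : ι → Fin n → ℂ}
    (hl : ∀ i, l i ≠ 0)
    (hne : ∀ i j, i ≠ j → ∃ u, l i ⬝ᵥ u = 0 ∧ l j ⬝ᵥ u ≠ 0) {d : ℕ} {s : ι → ℕ}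
    {t : ι → MvPolynomial (Fin n) ℂ} (ht : ∀ i ∈ T, (t i).IsHomogeneous d)
    (hdvd : ∀ i ∈ T, linForm (l i) ^ (d + 1 - s i) ∣ t i) (hs : ∑ i ∈ T, s i ≤ d + 1)
    (hsum : ∑ i ∈ T, t i = 0) : ∀ i ∈ T, t i = 0 := by
  classical
  induction d generalizing s t with
  | zero => ?_
  | succ d ih => ?_
  all_goals
    have hzero : ∀ i ∈ T, s i = 0 → t i = 0 := by
      intro i hi hsi
      by_contra h0
      have h1 := totalDegree_le_of_dvd_of_isDomain (hdvd i hi) h0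
      have h2 : ∀ e, (linForm (l i) ^ e).totalDegree = 1 * e := fun e =>
        ((linForm_isHomogeneous (l i)).pow e).totalDegree (pow_ne_zero e (linForm_ne_zero (hl i)))
      rw [h2, (ht i hi).totalDegree h0, hsi] at h1
      omega
    have hone : (∀ i ∈ T, ∀ j ∈ T, s i ≠ 0 → s j ≠ 0 → i = j) → ∀ i ∈ T, t i = 0 := by
      intro huniq i hi
      by_contra h0
      have hsi : s i ≠ 0 := fun h => h0 (hzero i hi h)
      rw [Finset.sum_eq_single_of_mem i hi] at hsum
      · exact h0 hsum
      · intro j hj hji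
        by_contra hj0
        exact hji (huniq j hj i hi (fun h => hj0 (hzero j hj h)) hsi)
  · refine hone fun i hi j hj hsi hsj => ?_
    by_contra hij
    have := Finset.add_le_sum (f := s) (fun _ _ => Nat.zero_le _) hi hj hij
    omega
  · by_cases huniq : ∀ i ∈ T, ∀ j ∈ T, s i ≠ 0 → s j ≠ 0 → i = j
    · exact hone huniq
    push Not at huniq
    obtain ⟨i, hi, j, hj, hsi, hsj, hij⟩ := huniq
    have hder : ∀ a ∈ T, s a ≠ 0 → ∀ v, l a ⬝ᵥ v = 0 → ∀ b ∈ T, dirDeriv v (t b) = 0 := by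
      intro a ha hsa v hv
      refine ih (s := Function.update s a (s a - 1)) (t := fun b => dirDeriv v (t b))
        (fun b hb => isHomogeneous_dirDeriv (ht b hb) v) (fun b hb => ?_) ?_ ?_
      · by_cases hba : b = a
        · subst hba
          obtain ⟨g, hg⟩ := hdvd b hb
          rw [Function.update_self, hg, Derivation.leibniz, dirDeriv_linForm_pow, hv, mul_zero,
            map_zero, zero_mul, smul_zero, add_zero, smul_eq_mul]
          exact (pow_dvd_pow _ (by omega)).mul_right _
        · rw [Function.update_of_ne hba]
          have := pow_dvd_dirDeriv v (hdvd b hb)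
          refine (pow_dvd_pow _ (by omega)).trans this
      · rw [Finset.sum_update_of_mem ha]
        rw [← Finset.add_sum_erase _ _ ha] at hs
        rw [Finset.sdiff_singleton_eq_erase]
        omega
      · rw [← map_sum, hsum, map_zero]
    intro b hb
    obtain ⟨u, hu, hu'⟩ := hne i j hij
    refine eq_zero_of_dirDeriv_eq_zero (Nat.succ_ne_zero d) (ht b hb) fun v => ?_
    have hv : v = (v - ((l j ⬝ᵥ v) / (l j ⬝ᵥ u)) • u) + ((l j ⬝ᵥ v) / (l j ⬝ᵥ u)) • u := by simp
    rw [hv, dirDeriv_add, dirDeriv_smul, hder i hi hsi u hu b hb, smul_zero, add_zero]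
    refine hder j hj hsj _ ?_ b hb
    rw [dotProduct_sub, dotProduct_smul, smul_eq_mul, div_mul_cancel₀ _ hu', sub_self]

theorem C_X_dvd_of_map_eq_zero {p : MvPolynomial (Fin n) (Polynomial ℂ)}
    (h : map Polynomial.constantCoeff p = 0) : C Polynomial.X ∣ p := by
  rw [C_dvd_iff_dvd_coeff]
  intro i
  rw [Polynomial.X_dvd_iff, ← Polynomial.constantCoeff_apply, ← coeff_map, h, coeff_zero]

/-- A combination of `d`-th powers of linear forms over `ℂ[ε]` that is divisible by `ε ^ m` splits
into the partial sums over the classes of forms with proportional values at `ε = 0`: each of these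
is divisible by `ε ^ m` as well, provided there are at most `d + 1` summands. Were some partial sum
less divisible, the leading terms would violate `eq_zero_of_sum_eq_zero`. -/
theorem exists_class_sums {ι τ : Type*} [Fintype ι] [DecidableEq τ] (T : Finset τ)
    {l : τ → Fin n → ℂ} (hl : ∀ A, l A ≠ 0)
    (hne : ∀ A B, A ≠ B → ∃ u, l A ⬝ᵥ u = 0 ∧ l B ⬝ᵥ u ≠ 0) (κ : ι → τ) (hκ : ∀ k, κ k ∈ T)
    {L : ι → Fin n → Polynomial ℂ}
    (hL : ∀ k, ∃ a : ℂ, a ≠ 0 ∧ Polynomial.constantCoeff ∘ L k = a • l (κ k))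
    {d : ℕ} (hd : Fintype.card ι ≤ d + 1) {c : ι → Polynomial ℂ} {m : ℕ}
    {F : MvPolynomial (Fin n) (Polynomial ℂ)}
    (h : ∑ k, C (c k) * linForm (L k) ^ d = C (Polynomial.X ^ m) * F) :
    ∃ G : τ → MvPolynomial (Fin n) (Polynomial ℂ),
      (∀ A, (G A).IsHomogeneous d) ∧
      (∀ A, ∑ k with κ k = A, C (c k) * linForm (L k) ^ d = C (Polynomial.X ^ m) * G A) ∧
      F = ∑ A ∈ T, G A := by
  have hX : ∀ m, (Polynomial.X ^ m : Polynomial ℂ) ≠ 0 := fun m =>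
    pow_ne_zero _ Polynomial.X_ne_zero
  have hCX : ∀ m, (C (Polynomial.X ^ m) : MvPolynomial (Fin n) (Polynomial ℂ)) ≠ 0 := fun m => by
    rw [Ne, C_eq_zero]; exact hX m
  have hhom : ∀ A, (∑ k with κ k = A, C (c k) * linForm (L k) ^ d).IsHomogeneous d := fun A =>
    IsHomogeneous.sum _ _ _ fun k _ => by
      simpa using ((linForm_isHomogeneous (L k)).pow d).C_mul (c k)
  have hfib : ∑ A ∈ T, ∑ k with κ k = A, C (c k) * linForm (L k) ^ d
      = C (Polynomial.X ^ m) * F := by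
    rw [← h]
    exact Finset.sum_fiberwise_of_maps_to (fun k _ => hκ k) _
  have key : ∀ q ≤ m, ∀ A, C (Polynomial.X ^ q) ∣
      ∑ k with κ k = A, C (c k) * linForm (L k) ^ d := by
    intro q
    induction q with
    | zero => intro _ A; simp
    | succ q ih =>
      intro hq A
      choose G hG using ih (by omega)
      have hGh : ∀ A, (G A).IsHomogeneous d := fun A =>
        isHomogeneous_of_C_mul (hX q) (by rw [← hG]; exact hhom A)
      have hsum : ∑ A ∈ T, G A = C (Polynomial.X ^ (m - q)) * F := by
        apply mul_left_cancel₀ (hCX q)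
        rw [← mul_assoc, ← map_mul, ← pow_add, Nat.add_sub_cancel' (by omega), ← hfib,
          Finset.mul_sum]
        exact Finset.sum_congr rfl fun A _ => (hG A).symm
      have h0 : ∀ A ∈ T, map Polynomial.constantCoeff (G A) = 0 := by
        refine eq_zero_of_sum_eq_zero T hl hne (d := d)
          (s := fun A => (Finset.univ.filter fun k => κ k = A).card)
          (fun A _ => (hGh A).map _) (fun A _ => ?_) ?_ ?_
        · refine linForm_pow_dvd_leading_term (hl A) L q _ (fun k hk => ?_) (hGh A) (hG A)
          obtain ⟨a, ha, hka⟩ := hL k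
          exact ⟨a, ha, by rw [hka, (Finset.mem_filter.1 hk).2]⟩
        · rw [← Finset.card_eq_sum_card_fiberwise fun k _ => hκ k]
          simpa using hd
        · rw [← map_sum, hsum, map_mul, map_C]
          rw [map_pow, Polynomial.constantCoeff_apply, Polynomial.coeff_X_zero,
            zero_pow (by omega), map_zero, zero_mul]
      by_cases hA : A ∈ T
      · rw [hG, pow_succ, map_mul]
        exact mul_dvd_mul_left _ (C_X_dvd_of_map_eq_zero (h0 A hA))
      · have hempty : (Finset.univ.filter fun k => κ k = A) = ∅ :=
          Finset.filter_eq_empty_iff.2 fun k _ hk => hA (hk ▸ hκ k)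
        rw [hempty, Finset.sum_empty]
        exact dvd_zero _
  choose G hG using key m le_rfl
  refine ⟨G, fun A => isHomogeneous_of_C_mul (hX m) (by rw [← hG]; exact hhom A), hG, ?_⟩
  apply mul_left_cancel₀ (hCX m)
  rw [← hfib, Finset.mul_sum]
  exact Finset.sum_congr rfl fun A _ => hG A

end

/-! ### Essential variables of a limit -/

section

variable {R S : Type*} [CommRing R] [CommRing S] {n : ℕ}

/-- The substitution `x ↦ x + v`. -/
noncomputable def translate (v : Fin n → R) :
    MvPolynomial (Fin n) R →ₐ[R] MvPolynomial (Fin n) R :=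
  aeval fun i => X i + C (v i)

theorem translate_linForm (v a : Fin n → R) :
    translate v (linForm a) = linForm a + C (a ⬝ᵥ v) := by
  simp [translate, linForm, dotProduct, mul_add, Finset.sum_add_distrib, algebraMap_eq]

theorem translate_C (v : Fin n → R) (c : R) : translate v (C c) = C c := by
  simp [translate, algebraMap_eq]

theorem map_translate (φ : R →+* S) (v : Fin n → R) (p : MvPolynomial (Fin n) R) :
    map φ (translate v p) = translate (φ ∘ v) (map φ p) := by
  induction p using MvPolynomial.induction_on with
  | C a => simp
  | add p q hp hq => simp [hp, hq]
  | mul_X p i hp => rw [map_mul, map_mul, map_mul, map_mul, hp]; simp [translate]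

theorem eval_translate (v x : Fin n → R) (p : MvPolynomial (Fin n) R) :
    eval x (translate v p) = eval (x + v) p := by
  induction p using MvPolynomial.induction_on with
  | C a => simp
  | add p q hp hq => simp [hp, hq]
  | mul_X p i hp => rw [map_mul, map_mul, map_mul, hp]; simp [translate]

end

section

variable {n : ℕ}

/-- The values at `ε = 0` of the vectors over `ℂ[ε]` on which the forms `L k`, `k ∈ s`, vanish. -/
def limitKernel {ι : Type*} (s : Finset ι) (L : ι → Fin n → Polynomial ℂ) :
    Submodule ℂ (Fin n → ℂ) where
  carrier := {v | ∃ u : Fin n → Polynomial ℂ,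
    Polynomial.constantCoeff ∘ u = v ∧ ∀ k ∈ s, L k ⬝ᵥ u = 0}
  zero_mem' := ⟨0, by ext; simp, by simp⟩
  add_mem' := by
    rintro _ _ ⟨u, rfl, hu⟩ ⟨w, rfl, hw⟩
    exact ⟨u + w, by ext; simp, fun k hk => by rw [dotProduct_add, hu k hk, hw k hk, add_zero]⟩
  smul_mem' := by
    rintro a _ ⟨u, rfl, hu⟩
    exact ⟨Polynomial.C a • u, by ext; simp, fun k hk => by
      rw [dotProduct_smul, hu k hk, smul_zero]⟩

/-- The common kernel of `#s` linear forms keeps codimension at most `#s` in the limit `ε → 0`.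
For the induction step, a vector on which the new form has the least order in `ε` is used to
eliminate that form from all the others. -/
theorem le_finrank_limitKernel {ι : Type*} (L : ι → Fin n → Polynomial ℂ) (s : Finset ι) :
    n ≤ Module.finrank ℂ (limitKernel s L) + s.card := by
  classical
  induction s using Finset.induction_on with
  | empty =>
    have : limitKernel (∅ : Finset ι) L = ⊤ := by
      refine eq_top_iff.2 fun v _ => ⟨Polynomial.C ∘ v, by ext; simp, by simp⟩
    rw [this]
    simp
  | insert k s hk ih =>
    rw [Finset.card_insert_of_notMem hk]
    obtain ⟨b, hb⟩ : ∃ b : Fin n → ℂ, limitKernel s L ≤ limitKernel (insert k s) L ⊔ ℂ ∙ b := by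
      by_cases h0 : ∀ u, (∀ j ∈ s, L j ⬝ᵥ u = 0) → L k ⬝ᵥ u = 0
      · refine ⟨0, le_sup_of_le_left ?_⟩
        rintro _ ⟨u, rfl, hu⟩
        refine ⟨u, rfl, fun j hj => ?_⟩
        rcases Finset.mem_insert.1 hj with rfl | hj
        exacts [h0 u hu, hu j hj]
      · push Not at h0
        have hex : ∃ a : ℕ, ∃ u, (∀ j ∈ s, L j ⬝ᵥ u = 0) ∧
            ∃ q : Polynomial ℂ, q.coeff 0 ≠ 0 ∧ L k ⬝ᵥ u = Polynomial.X ^ a * q := by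
          obtain ⟨u, hu, hku⟩ := h0
          obtain ⟨q, hq, hq'⟩ := Polynomial.exists_eq_pow_rootMultiplicity_mul_and_not_dvd _ hku 0
          rw [map_zero, sub_zero] at hq hq'
          exact ⟨_, u, hu, q, fun h => hq' (Polynomial.X_dvd_iff.2 h), hq⟩
        obtain ⟨b, hbs, q, hq, hkb⟩ := Nat.find_spec hex
        refine ⟨Polynomial.constantCoeff ∘ b, ?_⟩
        rintro _ ⟨u, rfl, hu⟩
        obtain ⟨g, hg⟩ : Polynomial.X ^ Nat.find hex ∣ L k ⬝ᵥ u := by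
          by_cases hku : L k ⬝ᵥ u = 0
          · rw [hku]; exact dvd_zero _
          obtain ⟨q', hq, hq'⟩ := Polynomial.exists_eq_pow_rootMultiplicity_mul_and_not_dvd _ hku 0
          rw [map_zero, sub_zero] at hq hq'
          have := Nat.find_min' hex ⟨u, hu, q', fun h => hq' (Polynomial.X_dvd_iff.2 h), hq⟩
          exact (pow_dvd_pow _ this).trans (Dvd.intro _ hq.symm)
        have hmem : Polynomial.constantCoeff ∘ (q • u - g • b) ∈ limitKernel (insert k s) L := by
          refine ⟨_, rfl, fun j hj => ?_⟩
          rw [dotProduct_sub, dotProduct_smul, dotProduct_smul, smul_eq_mul, smul_eq_mul]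
          rcases Finset.mem_insert.1 hj with rfl | hj
          · rw [hg, hkb]; ring
          · rw [hu j hj, hbs j hj]; ring
        have hu' : Polynomial.constantCoeff ∘ u
            = (q.coeff 0)⁻¹ • (Polynomial.constantCoeff ∘ (q • u - g • b))
              + ((q.coeff 0)⁻¹ * g.coeff 0) • (Polynomial.constantCoeff ∘ b) := by
          ext i
          simp
          field_simp
          ring
        rw [hu']
        exact Submodule.add_mem_sup (Submodule.smul_mem _ _ hmem)
          (Submodule.smul_mem _ _ (Submodule.mem_span_singleton_self _))
    have h1 := Submodule.finrank_mono hb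
    have h2 := Submodule.finrank_add_le_finrank_add_finrank (limitKernel (insert k s) L) (ℂ ∙ b)
    have h3 := finrank_span_le_card (R := ℂ) ({b} : Set (Fin n → ℂ))
    rw [Set.toFinset_singleton, Finset.card_singleton] at h3
    omega

/-- The leading term in `ε` of a combination of powers of the `L k` is invariant under translations
along their limit kernel. -/
theorem translate_leading_term {ι : Type*} {s : Finset ι} {L : ι → Fin n → Polynomial ℂ} {d m : ℕ}
    {c : ι → Polynomial ℂ} {F : MvPolynomial (Fin n) (Polynomial ℂ)}
    (h : ∑ k ∈ s, C (c k) * linForm (L k) ^ d = C (Polynomial.X ^ m) * F)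
    {v : Fin n → ℂ} (hv : v ∈ limitKernel s L) :
    translate v (map Polynomial.constantCoeff F) = map Polynomial.constantCoeff F := by
  obtain ⟨u, rfl, hu⟩ := hv
  rw [← map_translate]
  congr 1
  have hC : (C (Polynomial.X ^ m) : MvPolynomial (Fin n) (Polynomial ℂ)) ≠ 0 := by
    rw [Ne, C_eq_zero]; exact pow_ne_zero _ Polynomial.X_ne_zero
  apply mul_left_cancel₀ hC
  have h' := congrArg (translate u) h
  rw [map_mul, translate_C] at h'
  rw [← h', ← h, map_sum]
  refine Finset.sum_congr rfl fun k hk => ?_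
  rw [map_mul, map_pow, translate_C, translate_linForm, hu k hk, map_zero, add_zero]

/-- A form that is invariant under translations along a subspace of codimension at most `s` can be
written in `s` variables. -/
theorem exists_eq_aeval_linForm {V : Submodule ℂ (Fin n → ℂ)} {s : ℕ}
    (hV : n ≤ Module.finrank ℂ V + s) {p : MvPolynomial (Fin n) ℂ} {d : ℕ} (hp : p.IsHomogeneous d)
    (hinv : ∀ v ∈ V, translate v p = p) :
    ∃ (ρ : Fin s → Fin n → ℂ) (g : MvPolynomial (Fin s) ℂ), g.IsHomogeneous d ∧
      p = aeval (fun j => linForm (ρ j)) g := by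
  obtain ⟨ρ, σ, hρσ⟩ : ∃ (ρ : (Fin n → ℂ) →ₗ[ℂ] (Fin s → ℂ)) (σ : (Fin s → ℂ) →ₗ[ℂ] (Fin n → ℂ)),
      ∀ x, σ (ρ x) - x ∈ V := by
    have hq := V.finrank_quotient_add_finrank
    rw [Module.finrank_fin_fun] at hq
    obtain ⟨j, hj⟩ : ∃ j : ((Fin n → ℂ) ⧸ V) →ₗ[ℂ] (Fin s → ℂ), Function.Injective j := by
      apply finrank_le_iff_exists_linearMap.1
      rw [Module.finrank_fin_fun]
      omega
    obtain ⟨j', hj'⟩ := j.exists_leftInverse_of_injective (LinearMap.ker_eq_bot.2 hj)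
    obtain ⟨q', hq'⟩ := V.mkQ.exists_rightInverse_of_surjective V.range_mkQ
    refine ⟨j ∘ₗ V.mkQ, q' ∘ₗ j', fun x => ?_⟩
    rw [← Submodule.Quotient.mk_eq_zero, ← Submodule.mkQ_apply, map_sub, sub_eq_zero]
    have h1 := LinearMap.congr_fun hj' (V.mkQ x)
    have h2 := LinearMap.congr_fun hq' (V.mkQ x)
    simp only [LinearMap.comp_apply, LinearMap.id_apply] at h1 h2 ⊢
    rw [h1, h2]
  have hlin : ∀ {a b : ℕ} (f : (Fin a → ℂ) →ₗ[ℂ] (Fin b → ℂ)) (x : Fin a → ℂ) (i : Fin b),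
      eval x (linForm (LinearMap.toMatrix' f i)) = f x i := fun f x i => by
    rw [eval_linForm]
    exact congrFun (LinearMap.toMatrix'_mulVec f x) i
  refine ⟨LinearMap.toMatrix' ρ, aeval (fun i => linForm (LinearMap.toMatrix' σ i)) p, ?_, ?_⟩
  · have := hp.aeval (fun i => linForm (LinearMap.toMatrix' σ i)) fun i => linForm_isHomogeneous _
    rwa [one_mul] at this
  · apply MvPolynomial.funext
    intro x
    have hev : ∀ {a b : ℕ} (f : (Fin a → ℂ) →ₗ[ℂ] (Fin b → ℂ)) (x : Fin a → ℂ)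
        (q : MvPolynomial (Fin b) ℂ),
        eval x (aeval (fun i => linForm (LinearMap.toMatrix' f i)) q) = eval (f x) q := by
      intro a b f x q
      induction q using MvPolynomial.induction_on with
      | C a => simp
      | add p q hp hq => rw [map_add, map_add, map_add, hp, hq]
      | mul_X p i hp => rw [map_mul, map_mul, map_mul, hp, aeval_X, hlin, eval_X]
    have h1 := eval_translate (σ (ρ x) - x) x p
    rw [hinv _ (hρσ x), add_sub_cancel] at h1
    rw [hev, hev, h1]

end

/-! ### Upper bounds for Waring rank -/

section

variable {n : ℕ} {d : ℕ}

theorem waringRank_le {f : MvPolynomial (Fin n) ℂ} {r : ℕ} (h : HasDecomposition d f r) :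
    waringRank d f ≤ r :=
  iInf₂_le r h

theorem exists_hasDecomposition {f : MvPolynomial (Fin n) ℂ} (h : waringRank d f ≠ ⊤) :
    ∃ r : ℕ, HasDecomposition d f r ∧ waringRank d f = r := by
  classical
  by_cases hex : ∃ r, HasDecomposition d f r
  · exact ⟨Nat.find hex, Nat.find_spec hex, le_antisymm (waringRank_le (Nat.find_spec hex))
      (le_iInf₂ fun r hr => Nat.cast_le.2 (Nat.find_min' hex hr))⟩
  · refine (h ?_).elim
    push Not at hex
    simp [waringRank, hex]

theorem waringRank_zero : waringRank d (0 : MvPolynomial (Fin n) ℂ) = 0 := by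
  have h : HasDecomposition d (0 : MvPolynomial (Fin n) ℂ) 0 :=
    ⟨Fin.elim0, fun k => k.elim0, by simp⟩
  simpa using waringRank_le h

theorem waringRank_le_one {p : MvPolynomial (Fin n) ℂ} (h : IsSummand d p) :
    waringRank d p ≤ 1 := by
  have h : HasDecomposition d p 1 := ⟨fun _ => p, fun _ => h, by simp⟩
  simpa using waringRank_le h

theorem waringRank_add_le (f g : MvPolynomial (Fin n) ℂ) :
    waringRank d (f + g) ≤ waringRank d f + waringRank d g := by
  by_cases hf : waringRank d f = ⊤
  · simp [hf]
  by_cases hg : waringRank d g = ⊤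
  · simp [hg]
  obtain ⟨r, ⟨p, hp, rfl⟩, hr⟩ := exists_hasDecomposition hf
  obtain ⟨s, ⟨q, hq, rfl⟩, hs⟩ := exists_hasDecomposition hg
  rw [hr, hs, ← Nat.cast_add]
  refine waringRank_le ⟨Fin.append p q, fun k => ?_, by simp [Fin.sum_univ_add]⟩
  refine Fin.addCases (fun i => ?_) (fun i => ?_) k
  · rw [Fin.append_left]; exact hp i
  · rw [Fin.append_right]; exact hq i

theorem waringRank_sum_le {ι : Type*} (s : Finset ι) (f : ι → MvPolynomial (Fin n) ℂ) :
    waringRank d (∑ i ∈ s, f i) ≤ ∑ i ∈ s, waringRank d (f i) := by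
  classical
  induction s using Finset.induction_on with
  | empty => simp [waringRank_zero]
  | insert i s hi ih =>
    rw [Finset.sum_insert hi, Finset.sum_insert hi]
    exact (waringRank_add_le _ _).trans (add_le_add le_rfl ih)

theorem waringRank_sum_fin_le {r : ℕ} {p : Fin r → MvPolynomial (Fin n) ℂ} {b : ℕ∞}
    (h : ∀ k, waringRank d (p k) ≤ b) : waringRank d (∑ k, p k) ≤ r * b := by
  refine (waringRank_sum_le _ _).trans ((Finset.sum_le_sum fun k _ => h k).trans ?_)
  simp

/-- Over `ℂ` scalars can be absorbed into the linear form. -/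
theorem isSummand_C_mul_pow (hd : 1 ≤ d) {l : MvPolynomial (Fin n) ℂ} (hl : l.IsHomogeneous 1)
    (c : ℂ) : IsSummand d (C c * l ^ d) := by
  obtain ⟨a, rfl⟩ := IsAlgClosed.exists_pow_nat_eq c (n := d) (by omega)
  exact Or.inl ⟨hd, C a * l, hl.C_mul a, by rw [mul_pow, map_pow]⟩

/-- A product `ℓᵃ mᵇ` with `a, b ≥ 1` is a combination of the `a + b` powers `(ℓ + ζʲ m) ^ (a + b)`,
where `ζ` is a primitive root of unity of order `a + b`: averaging them against the character
`j ↦ ζ ^ (a j)` singles out the monomial `ℓᵃ mᵇ` in the binomial expansion. -/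
theorem waringRank_pow_mul_pow_le {a b : ℕ} (ha : 1 ≤ a) (hb : 1 ≤ b)
    {l m : MvPolynomial (Fin n) ℂ} (hl : l.IsHomogeneous 1) (hm : m.IsHomogeneous 1) :
    waringRank (a + b) (l ^ a * m ^ b) ≤ (a + b : ℕ) := by
  set D := a + b with hD
  obtain ⟨ζ, hζ⟩ : ∃ ζ : ℂ, IsPrimitiveRoot ζ D :=
    ⟨_, Complex.isPrimitiveRoot_exp D (by omega)⟩
  have hgeom : ∀ i ∈ Finset.range (D + 1), i ≠ b → ∑ j : Fin D, (ζ ^ (a + i)) ^ (j : ℕ) = 0 := by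
    intro i hi hib
    rw [Finset.mem_range] at hi
    have h1 : ζ ^ (a + i) ≠ 1 := by
      rw [Ne, hζ.pow_eq_one_iff_dvd]
      rintro ⟨q, hq⟩
      have hq1 : q = 1 := by
        have h2 : D * q < D * 2 := by omega
        have h3 : q ≠ 0 := by rintro rfl; omega
        have := Nat.lt_of_mul_lt_mul_left h2
        omega
      subst hq1
      omega
    have h2 := mul_geom_sum (ζ ^ (a + i)) D
    rw [← pow_mul, mul_comm (a + i), pow_mul, hζ.pow_eq_one, one_pow, sub_self] at h2
    rw [Fin.sum_univ_eq_sum_range fun j => (ζ ^ (a + i)) ^ j]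
    exact (mul_eq_zero.1 h2).resolve_left (sub_ne_zero.2 h1)
  have hgeom' : ∑ j : Fin D, (ζ ^ (a + b)) ^ (j : ℕ) = D := by
    rw [← hD, hζ.pow_eq_one]; simp
  have hsum : ∑ j : Fin D, C (ζ ^ (a * (j : ℕ))) * (C (ζ ^ (j : ℕ)) * m + l) ^ D
      = C ((D : ℂ) * (D.choose b : ℂ)) * (l ^ a * m ^ b) := by
    have h1 : ∀ j : Fin D, C (ζ ^ (a * (j : ℕ))) * (C (ζ ^ (j : ℕ)) * m + l) ^ D
        = ∑ i ∈ Finset.range (D + 1),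
          C ((ζ ^ (a + i)) ^ (j : ℕ)) * (C (D.choose i : ℂ) * (l ^ (D - i) * m ^ i)) := fun j => by
      rw [add_pow, Finset.mul_sum]
      refine Finset.sum_congr rfl fun i _ => ?_
      rw [mul_pow, ← map_pow, map_natCast]
      have : (ζ ^ (a + i)) ^ (j : ℕ) = ζ ^ (a * (j : ℕ)) * (ζ ^ (j : ℕ)) ^ i := by ring
      rw [this, map_mul]
      ring
    simp only [h1]
    rw [Finset.sum_comm, Finset.sum_eq_single_of_mem b (Finset.mem_range.2 (by omega))]
    · rw [← Finset.sum_mul, ← map_sum, hgeom', ← mul_assoc, ← map_mul, hD, Nat.add_sub_cancel]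
    · intro i hi hib
      rw [← Finset.sum_mul, ← map_sum, hgeom i hi hib, map_zero, zero_mul]
  have hc : (D : ℂ) * (D.choose b : ℂ) ≠ 0 :=
    mul_ne_zero (by exact_mod_cast (by omega : D ≠ 0))
      (by exact_mod_cast (Nat.choose_pos (by omega : b ≤ D)).ne')
  have hfin : l ^ a * m ^ b = ∑ j : Fin D, C (((D : ℂ) * (D.choose b : ℂ))⁻¹ * ζ ^ (a * (j : ℕ)))
      * (C (ζ ^ (j : ℕ)) * m + l) ^ D := by
    simp only [map_mul C (((D : ℂ) * (D.choose b : ℂ))⁻¹), mul_assoc]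
    rw [← Finset.mul_sum, hsum, ← mul_assoc, ← map_mul, inv_mul_cancel₀ hc, map_one, one_mul]
  exact waringRank_le ⟨_, fun j => isSummand_C_mul_pow (by omega) ((hm.C_mul _).add hl) _, hfin⟩

theorem waringRank_pow_mul_le {e b : ℕ} (heb : 1 ≤ e + b) {l : MvPolynomial (Fin n) ℂ}
    (hl : l.IsHomogeneous 1) (g : MvPolynomial (Fin n) ℂ) :
    waringRank (e + b) (l ^ e * g) ≤ waringRank b g * (e + b : ℕ) := by
  have hone : (1 : ℕ∞) ≤ (e + b : ℕ) := by exact_mod_cast heb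
  by_cases hg : waringRank b g = ⊤
  · rw [hg, ENat.top_mul (by exact_mod_cast (by omega : e + b ≠ 0))]
    exact le_top
  obtain ⟨r, ⟨p, hp, rfl⟩, hr⟩ := exists_hasDecomposition hg
  rw [hr, Finset.mul_sum]
  refine waringRank_sum_fin_le fun k => ?_
  rcases hp k with ⟨hb, m, hm, hpk⟩ | ⟨rfl, hpk⟩
  · rw [hpk]
    rcases Nat.eq_zero_or_pos e with rfl | he
    · refine (waringRank_le_one ?_).trans hone
      simpa using isSummand_C_mul_pow (d := 0 + b) heb hm 1
    · exact waringRank_pow_mul_pow_le he hb hl hm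
  · rw [← totalDegree_zero_iff_isHomogeneous, totalDegree_eq_zero_iff_eq_C] at hpk
    rw [hpk, mul_comm]
    exact (waringRank_le_one (isSummand_C_mul_pow heb hl _)).trans hone

theorem waringRank_aeval_le {s : ℕ} (ρ : Fin s → Fin n → ℂ) (g : MvPolynomial (Fin s) ℂ) :
    waringRank d (aeval (fun j => linForm (ρ j)) g) ≤ waringRank d g := by
  by_cases hg : waringRank d g = ⊤
  · rw [hg]; exact le_top
  obtain ⟨r, ⟨p, hp, rfl⟩, hr⟩ := exists_hasDecomposition hg
  have hρ : ∀ {q : MvPolynomial (Fin s) ℂ} {e : ℕ}, q.IsHomogeneous e →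
      (aeval (fun j => linForm (ρ j)) q).IsHomogeneous e := fun hq => by
    have := hq.aeval (fun j => linForm (ρ j)) fun j => linForm_isHomogeneous _
    rwa [one_mul] at this
  rw [hr]
  refine waringRank_le ⟨fun k => aeval (fun j => linForm (ρ j)) (p k), fun k => ?_, map_sum _ _ _⟩
  rcases hp k with ⟨hd, l, hl, hpk⟩ | ⟨hd, hpk⟩
  · exact Or.inl ⟨hd, _, hρ hl, by simp only [hpk, map_pow]⟩
  · exact Or.inr ⟨hd, hρ hpk⟩

theorem waringRank_le_maxR {f : MvPolynomial (Fin n) ℂ} (hf : f.IsHomogeneous d) :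
    waringRank d f ≤ maxR n d :=
  le_iSup₂ (f := fun (f : MvPolynomial (Fin n) ℂ) (_ : f.IsHomogeneous d) => waringRank d f) f hf

/-- By Euler's identity a form of degree `d + 1` is a sum of products `xᵢ gᵢ` with `gᵢ` of degree
`d`, so that `maxR n (d + 1) ≤ n * (maxR n d * (d + 1))`. -/
theorem maxR_lt_top (n d : ℕ) : maxR n d < ⊤ := by
  induction d with
  | zero =>
    refine lt_of_le_of_lt (b := 1) (iSup₂_le fun f hf => ?_) (ENat.natCast_lt_top 1)
    exact waringRank_le_one (Or.inr ⟨rfl, hf⟩)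
  | succ d ih =>
    refine lt_of_le_of_lt (b := (n : ℕ∞) * (maxR n d * (1 + d : ℕ))) (iSup₂_le fun f hf => ?_)
      (WithTop.mul_lt_top (ENat.natCast_lt_top _) (WithTop.mul_lt_top ih (ENat.natCast_lt_top _)))
    have hd : ((d + 1 : ℕ) : ℂ) ≠ 0 := by exact_mod_cast Nat.succ_ne_zero d
    have hE : f = ∑ i : Fin n, X i ^ 1 * (C ((d + 1 : ℕ) : ℂ)⁻¹ * pderiv i f) := by
      have h := hf.sum_X_mul_pderiv
      have h2 : ∑ i : Fin n, X i ^ 1 * (C ((d + 1 : ℕ) : ℂ)⁻¹ * pderiv i f)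
          = C ((d + 1 : ℕ) : ℂ)⁻¹ * ∑ i : Fin n, X i * pderiv i f := by
        rw [Finset.mul_sum]
        exact Finset.sum_congr rfl fun i _ => by ring
      rw [h2, h, nsmul_eq_mul, ← map_natCast (C : ℂ →+* MvPolynomial (Fin n) ℂ), ← mul_assoc,
        ← map_mul, inv_mul_cancel₀ hd, map_one, one_mul]
    rw [hE, add_comm d 1]
    refine waringRank_sum_fin_le fun i => ?_
    refine (waringRank_pow_mul_le (by omega) (isHomogeneous_X ℂ i) _).trans ?_
    gcongr
    exact waringRank_le_maxR (hf.pderiv.C_mul _)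

theorem exists_pderiv_eq (i : Fin n) {f : MvPolynomial (Fin n) ℂ} (hf : f.IsHomogeneous d) :
    ∃ g : MvPolynomial (Fin n) ℂ, g.IsHomogeneous (d + 1) ∧ pderiv i g = f := by
  refine ⟨∑ m ∈ f.support, monomial (m + Finsupp.single i 1) (f.coeff m / (m i + 1)), ?_, ?_⟩
  · refine IsHomogeneous.sum _ _ _ fun m hm => isHomogeneous_monomial _ ?_
    rw [map_add, Finsupp.degree_single, hf.degree_eq_sum_deg_support hm]
    rfl
  · conv_rhs => rw [f.as_sum]
    rw [map_sum]
    refine Finset.sum_congr rfl fun m _ => ?_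
    have : (m i + 1 : ℂ) ≠ 0 := by exact_mod_cast Nat.succ_ne_zero (m i)
    rw [pderiv_monomial, add_tsub_cancel_right]
    congr 1
    simp [this]

theorem waringRank_pderiv_le (hd : 1 ≤ d) (i : Fin n) (g : MvPolynomial (Fin n) ℂ) :
    waringRank d (pderiv i g) ≤ waringRank (d + 1) g := by
  by_cases hg : waringRank (d + 1) g = ⊤
  · rw [hg]; exact le_top
  obtain ⟨r, ⟨p, hp, rfl⟩, hr⟩ := exists_hasDecomposition hg
  rw [hr]
  refine waringRank_le ⟨fun k => pderiv i (p k), fun k => ?_, map_sum _ _ _⟩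
  rcases hp k with ⟨_, l, hl, hpk⟩ | ⟨h, _⟩
  · obtain ⟨a, rfl⟩ := exists_eq_linForm hl
    simp only [hpk]
    rw [← dirDeriv_single, dirDeriv_linForm_pow, Nat.add_sub_cancel]
    exact isSummand_C_mul_pow hd hl _
  · omega

/-- Every form of degree `d` is a derivative of a form of degree `d + 1`, and differentiation turns
Waring decompositions into Waring decompositions. -/
theorem maxR_mono_right {s : ℕ} (hs : 0 < s) {d e : ℕ} (hd : 1 ≤ d) (hde : d ≤ e) :
    maxR s d ≤ maxR s e := by
  induction e, hde using Nat.le_induction with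
  | base => exact le_rfl
  | succ e hde ih =>
    refine ih.trans (iSup₂_le fun f hf => ?_)
    obtain ⟨g, hg, rfl⟩ := exists_pderiv_eq ⟨0, hs⟩ hf
    exact (waringRank_pderiv_le (by omega) _ g).trans (waringRank_le_maxR hg)

theorem sum_maxR_le_partitionMaxR {r : ℕ} (P : Nat.Partition r) :
    (P.parts.map fun s => maxR s (s - 1)).sum ≤ partitionMaxR r :=
  le_iSup (fun P : Nat.Partition r => (P.parts.map fun s => maxR s (s - 1)).sum) P

theorem partitionMaxR_lt_top (r : ℕ) : partitionMaxR r < ⊤ := by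
  have h : ∀ P : Nat.Partition r, (P.parts.map fun s => maxR s (s - 1)).sum < ⊤ := fun P => by
    refine Multiset.sum_induction (· < (⊤ : ℕ∞)) _ (fun a b ha hb => WithTop.add_lt_top.2 ⟨ha, hb⟩)
      (ENat.natCast_lt_top 0) fun a ha => ?_
    obtain ⟨s, _, rfl⟩ := Multiset.mem_map.1 ha
    exact maxR_lt_top _ _
  refine lt_of_le_of_lt (b := ∑ P : Nat.Partition r, (P.parts.map fun s => maxR s (s - 1)).sum)
    (iSup_le fun P => ?_) (WithTop.sum_lt_top.2 fun P _ => h P)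
  exact Finset.single_le_sum (f := fun P : Nat.Partition r =>
    (P.parts.map fun s => maxR s (s - 1)).sum) (fun _ _ => zero_le) (Finset.mem_univ P)

end

/-! ### Clearing denominators and assembling the bound -/

section

variable {n : ℕ} {d : ℕ}

/-- A vector over `ℂ(ε)` is a scalar multiple of a polynomial vector that does not vanish at
`ε = 0`. -/
theorem exists_primitive_vector (hn : 0 < n) (a : Fin n → RatFunc ℂ) :
    ∃ (q : RatFunc ℂ) (L : Fin n → Polynomial ℂ), Polynomial.constantCoeff ∘ L ≠ 0 ∧
      a = q • (algebraMap (Polynomial ℂ) (RatFunc ℂ) ∘ L) := by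
  classical
  let _ : NormalizedGCDMonoid (Polynomial ℂ) :=
    Classical.choice (inferInstanceAs (Nonempty (NormalizedGCDMonoid (Polynomial ℂ))))
  obtain ⟨b, hb⟩ := IsLocalization.exist_integer_multiples_of_finite
    (nonZeroDivisors (Polynomial ℂ)) a
  choose P hP using hb
  obtain ⟨L, hL, hgcd⟩ := Finset.extract_gcd P (⟨⟨0, hn⟩, Finset.mem_univ _⟩ :
    (Finset.univ : Finset (Fin n)).Nonempty)
  have hb0 : algebraMap (Polynomial ℂ) (RatFunc ℂ) b ≠ 0 :=
    IsFractionRing.to_map_ne_zero_of_mem_nonZeroDivisors b.2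
  refine ⟨(algebraMap _ (RatFunc ℂ) (b : Polynomial ℂ))⁻¹
    * algebraMap _ (RatFunc ℂ) (Finset.univ.gcd P), L, fun h0 => ?_, ?_⟩
  · -- otherwise `ε` would divide the greatest common divisor of the `L i`, which is `1`
    have hX : (Polynomial.X : Polynomial ℂ) ∣ Finset.univ.gcd L :=
      Finset.dvd_gcd fun i _ => Polynomial.X_dvd_iff.2 (congrFun h0 i)
    rw [hgcd] at hX
    exact Polynomial.not_isUnit_X (isUnit_of_dvd_one hX)
  · ext i
    have h1 := hP i
    rw [hL i (Finset.mem_univ i), map_mul, Algebra.smul_def] at h1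
    rw [Pi.smul_apply, Function.comp_apply, smul_eq_mul, mul_assoc, h1, inv_mul_cancel_left₀ hb0]

/-- A rational function with a finite limit at `0` has no pole there. -/
theorem eval_num_denom_of_tendsto {q : RatFunc ℂ} {a : ℂ}
    (h : Tendsto (fun ε : ℂ => RatFunc.eval (RingHom.id ℂ) ε q) (𝓝[≠] 0) (𝓝 a)) :
    q.denom.eval 0 ≠ 0 ∧ q.num.eval 0 = a * q.denom.eval 0 := by
  have hden : Tendsto (fun ε : ℂ => q.denom.eval ε) (𝓝[≠] 0) (𝓝 (q.denom.eval 0)) :=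
    q.denom.continuous.continuousAt.tendsto.mono_left nhdsWithin_le_nhds
  have hnum : Tendsto (fun ε : ℂ => q.num.eval ε) (𝓝[≠] 0) (𝓝 (q.num.eval 0)) :=
    q.num.continuous.continuousAt.tendsto.mono_left nhdsWithin_le_nhds
  have hfin : ∀ᶠ ε in 𝓝[≠] (0 : ℂ), q.denom.eval ε ≠ 0 := by
    have hs : (q.denom.rootSet ℂ).Finite := Polynomial.rootSet_finite _ _
    have h1 : ∀ᶠ ε in 𝓝[≠] (0 : ℂ), ε ∈ (q.denom.rootSet ℂ \ {0})ᶜ :=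
      mem_nhdsWithin_of_mem_nhds ((hs.subset Set.sdiff_subset).isClosed.isOpen_compl.mem_nhds
        (by simp))
    filter_upwards [h1, self_mem_nhdsWithin] with ε hε h0 hroot
    exact hε ⟨(Polynomial.mem_rootSet_of_ne q.denom_ne_zero).2 (by simpa using hroot), h0⟩
  have heq : ∀ᶠ ε in 𝓝[≠] (0 : ℂ),
      RatFunc.eval (RingHom.id ℂ) ε q * q.denom.eval ε = q.num.eval ε := by
    filter_upwards [hfin] with ε hε
    rw [RatFunc.eval, Polynomial.eval₂_id, Polynomial.eval₂_id, div_mul_cancel₀ _ hε]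
  have hlim : q.num.eval 0 = a * q.denom.eval 0 :=
    tendsto_nhds_unique hnum ((h.mul hden).congr' heq)
  refine ⟨fun h0 => ?_, hlim⟩
  rw [h0, mul_zero] at hlim
  obtain ⟨u, v, huv⟩ := q.isCoprime_num_denom
  have := congrArg (Polynomial.eval 0) huv
  simp [h0, hlim] at this

/-- If `G / (X ^ m * Q)` has a finite limit at `0`, then `X ^ m` divides `G`, and the values at `0`
of the cofactor and of `Q` differ by the factor given by the limit. -/
theorem exists_eq_X_pow_mul_of_tendsto {q : RatFunc ℂ} {a : ℂ}
    (h : Tendsto (fun ε : ℂ => RatFunc.eval (RingHom.id ℂ) ε q) (𝓝[≠] 0) (𝓝 a))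
    {m : ℕ} {Q G : Polynomial ℂ}
    (hG : algebraMap (Polynomial ℂ) (RatFunc ℂ) G
      = algebraMap (Polynomial ℂ) (RatFunc ℂ) (Polynomial.X ^ m * Q) * q) :
    ∃ G', G = Polynomial.X ^ m * G' ∧ G'.eval 0 = Q.eval 0 * a := by
  obtain ⟨hden, hnum⟩ := eval_num_denom_of_tendsto h
  have hpoly : G * q.denom = Polynomial.X ^ m * Q * q.num := by
    apply RatFunc.algebraMap_injective ℂ
    have hd0 : algebraMap (Polynomial ℂ) (RatFunc ℂ) q.denom ≠ 0 :=
      RatFunc.algebraMap_ne_zero q.denom_ne_zero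
    rw [map_mul, hG, map_mul _ _ q.num]
    conv_lhs => rw [← RatFunc.num_div_denom q]
    field_simp
    simp
  have hdvd : Polynomial.X ^ m ∣ G := by
    refine (Polynomial.prime_X.pow_dvd_of_dvd_mul_right m (b := q.denom) ?_ ?_)
    · rwa [Polynomial.X_dvd_iff, Polynomial.coeff_zero_eq_eval_zero]
    · rw [hpoly, mul_assoc]
      exact dvd_mul_right _ _
  obtain ⟨G', rfl⟩ := hdvd
  refine ⟨G', rfl, ?_⟩
  rw [mul_assoc, mul_assoc] at hpoly
  have := congrArg (Polynomial.eval 0)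
    (mul_left_cancel₀ (pow_ne_zero m Polynomial.X_ne_zero) hpoly)
  rw [Polynomial.eval_mul, Polynomial.eval_mul, hnum, ← mul_assoc] at this
  exact mul_right_cancel₀ hden this

/-- Denominators can be cleared in a border Waring decomposition: `f` is the value at `ε = 0` of
`ε ^ (-m)` times a combination of powers of linear forms over `ℂ[ε]` that do not vanish at
`ε = 0`. -/
theorem exists_polynomial_decomposition (hn : 0 < n) (hd : 1 ≤ d) {f : MvPolynomial (Fin n) ℂ}
    {r : ℕ} (h : HasBorderDecomposition d f r) :
    ∃ (c : Fin r → Polynomial ℂ) (L : Fin r → Fin n → Polynomial ℂ) (m : ℕ)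
      (F : MvPolynomial (Fin n) (Polynomial ℂ)),
      (∀ k, Polynomial.constantCoeff ∘ L k ≠ 0) ∧ F.IsHomogeneous d ∧
      ∑ k, C (c k) * linForm (L k) ^ d = C (Polynomial.X ^ m) * F ∧
      map Polynomial.constantCoeff F = f := by
  obtain ⟨p, hp, hlim⟩ := h
  have hex : ∀ k, ∃ (q : RatFunc ℂ) (L : Fin n → Polynomial ℂ),
      Polynomial.constantCoeff ∘ L ≠ 0 ∧
        p k = C (q ^ d) * linForm (algebraMap (Polynomial ℂ) (RatFunc ℂ) ∘ L) ^ d := by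
    intro k
    rcases hp k with ⟨_, l, hl, hpk⟩ | ⟨h0, _⟩
    · obtain ⟨a, rfl⟩ := exists_eq_linForm hl
      obtain ⟨q, L, hL, rfl⟩ := exists_primitive_vector hn a
      exact ⟨q, L, hL, by rw [hpk, linForm_smul, mul_pow, map_pow]⟩
    · omega
  choose q L hL hpk using hex
  obtain ⟨b, hb⟩ := IsLocalization.exist_integer_multiples_of_finite
    (nonZeroDivisors (Polynomial ℂ)) fun k => q k ^ d
  choose c hc using hb
  obtain ⟨Q, hQ, hQ0⟩ := Polynomial.exists_eq_pow_rootMultiplicity_mul_and_not_dvd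
    (b : Polynomial ℂ) (nonZeroDivisors.ne_zero b.2) 0
  rw [map_zero, sub_zero] at hQ hQ0
  rw [Polynomial.X_dvd_iff, Polynomial.coeff_zero_eq_eval_zero] at hQ0
  set m := Polynomial.rootMultiplicity 0 (b : Polynomial ℂ)
  obtain ⟨G, hG⟩ : ∃ G, G = ∑ k, C (c k) * linForm (L k) ^ d := ⟨_, rfl⟩
  have hGhom : G.IsHomogeneous d := by
    rw [hG]
    exact IsHomogeneous.sum _ _ _ fun k _ => by
      simpa using ((linForm_isHomogeneous (L k)).pow d).C_mul (c k)
  have hmap : map (algebraMap (Polynomial ℂ) (RatFunc ℂ)) G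
      = C (algebraMap (Polynomial ℂ) (RatFunc ℂ) (Polynomial.X ^ m * Q)) * ∑ k, p k := by
    rw [hG, map_sum, Finset.mul_sum]
    refine Finset.sum_congr rfl fun k _ => ?_
    have h1 := hc k
    simp only [Algebra.smul_def] at h1
    rw [map_mul, map_pow, map_linForm, map_C, h1, hpk, ← hQ, ← mul_assoc, ← map_mul]
  have hcoeff : ∀ μ, ∃ G', G.coeff μ = Polynomial.X ^ m * G' ∧
      G'.eval 0 = Q.eval 0 * f.coeff μ := fun μ => by
    refine exists_eq_X_pow_mul_of_tendsto (hlim μ) ?_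
    rw [← coeff_map, hmap, coeff_C_mul]
  obtain ⟨F, hF⟩ : C (Polynomial.X ^ m) ∣ G := by
    rw [C_dvd_iff_dvd_coeff]
    intro μ
    obtain ⟨G', h1, _⟩ := hcoeff μ
    exact Dvd.intro _ h1.symm
  have hXm : (Polynomial.X ^ m : Polynomial ℂ) ≠ 0 := pow_ne_zero m Polynomial.X_ne_zero
  -- the constant `Q(0)` is absorbed into the coefficients
  refine ⟨fun k => Polynomial.C (Q.eval 0)⁻¹ * c k, L, m, C (Polynomial.C (Q.eval 0)⁻¹) * F, hL,
    (isHomogeneous_of_C_mul hXm (hF ▸ hGhom)).C_mul _, ?_, ?_⟩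
  · rw [mul_left_comm, ← hF, hG, Finset.mul_sum]
    exact Finset.sum_congr rfl fun k _ => by rw [map_mul, mul_assoc]
  · ext μ
    obtain ⟨G', h1, h2⟩ := hcoeff μ
    rw [hF, coeff_C_mul] at h1
    rw [coeff_map, coeff_C_mul, mul_left_cancel₀ hXm h1, map_mul, Polynomial.constantCoeff_apply,
      Polynomial.constantCoeff_apply, Polynomial.coeff_C_zero, Polynomial.coeff_zero_eq_eval_zero,
      h2, inv_mul_cancel_left₀ hQ0]

theorem exists_dotProduct_eq_zero_ne_zero {a b : Fin n → ℂ} (ha : a ≠ 0)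
    (hab : ∀ z : ℂ, z • a ≠ b) : ∃ u, a ⬝ᵥ u = 0 ∧ b ⬝ᵥ u ≠ 0 := by
  obtain ⟨w, hw⟩ := exists_dotProduct_eq_one ha
  obtain ⟨y, hy⟩ := exists_dotProduct_eq_one (sub_ne_zero.2 (hab (b ⬝ᵥ w)).symm)
  refine ⟨y - (a ⬝ᵥ y) • w, ?_, ?_⟩
  · rw [dotProduct_sub, dotProduct_smul, hw, smul_eq_mul, mul_one, sub_self]
  · rw [sub_dotProduct, smul_dotProduct, smul_eq_mul] at hy
    rw [dotProduct_sub, dotProduct_smul, smul_eq_mul, mul_comm, hy]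
    exact one_ne_zero

/-- The contribution of one class of linear forms. The leading term is `ℓ ^ (d + 1 - s) * g`, where
`s` is the number of forms in the class; the cofactor `g` has degree `s - 1`, and it is invariant
under translations along the limit kernel, so that it can be written in `s` variables. -/
theorem waringRank_leading_term_le {ι : Type*} (hd : 1 ≤ d) {l : Fin n → ℂ} (hl : l ≠ 0)
    {L : ι → Fin n → Polynomial ℂ} {s : Finset ι} (hs : s.Nonempty) (hsd : s.card ≤ d + 1)
    (hL : ∀ k ∈ s, ∃ a : ℂ, a ≠ 0 ∧ Polynomial.constantCoeff ∘ L k = a • l)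
    {c : ι → Polynomial ℂ} {m : ℕ} {F : MvPolynomial (Fin n) (Polynomial ℂ)}
    (hF : F.IsHomogeneous d)
    (h : ∑ k ∈ s, C (c k) * linForm (L k) ^ d = C (Polynomial.X ^ m) * F) :
    waringRank d (map Polynomial.constantCoeff F) ≤ maxR s.card (s.card - 1) * d := by
  have hs0 := hs.card_pos
  obtain ⟨e, he⟩ : ∃ e, e = d + 1 - s.card := ⟨_, rfl⟩
  have hle : (linForm l ^ e).IsHomogeneous e := by
    simpa using (linForm_isHomogeneous l).pow e
  obtain ⟨g, hg, hFg⟩ := exists_homogeneous_cofactor hle (hF.map Polynomial.constantCoeff)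
    (by omega) (he ▸ linForm_pow_dvd_leading_term hl L m s hL hF h)
  have hinv : ∀ v ∈ limitKernel s L, translate v g = g := by
    intro v hv
    have hlv : l ⬝ᵥ v = 0 := by
      obtain ⟨k, hk⟩ := hs
      obtain ⟨a, ha, hka⟩ := hL k hk
      obtain ⟨u, rfl, hu⟩ := hv
      have h0 := congrArg Polynomial.constantCoeff (hu k hk)
      rw [RingHom.map_dotProduct, hka, smul_dotProduct, map_zero, smul_eq_mul] at h0
      exact (mul_eq_zero.1 h0).resolve_left ha
    have ht := translate_leading_term h hv
    rw [hFg, map_mul, map_pow, translate_linForm, hlv, map_zero, add_zero] at ht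
    exact mul_left_cancel₀ (pow_ne_zero e (linForm_ne_zero hl)) ht
  obtain ⟨ρ, g', hg', hgg'⟩ := exists_eq_aeval_linForm (le_finrank_limitKernel L s) hg hinv
  obtain ⟨b, hb⟩ : ∃ b, b = s.card - 1 := ⟨_, rfl⟩
  have hdeb : d - e = b := by omega
  have hde : d = e + b := by omega
  rw [hdeb] at hg'
  rw [hFg, ← hb]
  have h1 := waringRank_pow_mul_le (b := b) (hde ▸ hd) (linForm_isHomogeneous l) g
  rw [← hde] at h1
  refine h1.trans ?_
  gcongr
  rw [hgg']
  exact (waringRank_aeval_le ρ g').trans (waringRank_le_maxR hg')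

/-- The bound for a polynomial family. For `r ≤ d + 1` the summands are grouped by the point of
projective space that their linear forms specialise to, and each group contributes separately. -/
theorem waringRank_le_partitionMaxR_mul (hd : 1 ≤ d) {r : ℕ} {L : Fin r → Fin n → Polynomial ℂ}
    (hL : ∀ k, Polynomial.constantCoeff ∘ L k ≠ 0) {c : Fin r → Polynomial ℂ} {m : ℕ}
    {F : MvPolynomial (Fin n) (Polynomial ℂ)} (hF : F.IsHomogeneous d)
    (h : ∑ k, C (c k) * linForm (L k) ^ d = C (Polynomial.X ^ m) * F) :
    waringRank d (map Polynomial.constantCoeff F) ≤ partitionMaxR r * d := by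
  classical
  rcases le_or_gt r (d + 1) with hr | hr
  · let κ : Fin r → Projectivization ℂ (Fin n → ℂ) := fun k => Projectivization.mk ℂ _ (hL k)
    have hκ : ∀ k, ∃ a : ℂ, a ≠ 0 ∧ Polynomial.constantCoeff ∘ L k = a • (κ k).rep := fun k => by
      obtain ⟨a, ha⟩ := Projectivization.exists_smul_eq_mk_rep ℂ _ (hL k)
      refine ⟨(a⁻¹ : ℂˣ), Units.ne_zero _, ?_⟩
      rw [← ha, ← Units.smul_def, inv_smul_smul]
    have hne : ∀ A B : Projectivization ℂ (Fin n → ℂ), A ≠ B →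
        ∃ u, A.rep ⬝ᵥ u = 0 ∧ B.rep ⬝ᵥ u ≠ 0 := fun A B hAB => by
      refine exists_dotProduct_eq_zero_ne_zero A.rep_nonzero fun z hz => hAB ?_
      rw [← A.mk_rep, ← B.mk_rep, eq_comm, Projectivization.mk_eq_mk_iff']
      exact ⟨z, hz⟩
    obtain ⟨T, hT⟩ : ∃ T, T = Finset.univ.image κ := ⟨_, rfl⟩
    have hκT : ∀ k, κ k ∈ T := fun k => hT ▸ Finset.mem_image_of_mem κ (Finset.mem_univ k)
    obtain ⟨G, hGhom, hG, hFG⟩ := exists_class_sums T (fun A => A.rep_nonzero) hne κ hκT hκ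
      (by simpa using hr) h
    have hcard : ∑ A ∈ T, (Finset.univ.filter fun k => κ k = A).card = r := by
      rw [← Finset.card_eq_sum_card_fiberwise fun k _ => hκT k]
      simp
    have hpos : ∀ A ∈ T, (Finset.univ.filter fun k => κ k = A).Nonempty := fun A hA => by
      rw [hT] at hA
      obtain ⟨k, _, hk⟩ := Finset.mem_image.1 hA
      exact ⟨k, Finset.mem_filter.2 ⟨Finset.mem_univ k, hk⟩⟩
    let P : Nat.Partition r :=
      { parts := T.val.map fun A => (Finset.univ.filter fun k => κ k = A).card
        parts_pos := by
          intro i hi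
          obtain ⟨A, hA, rfl⟩ := Multiset.mem_map.1 hi
          exact (hpos A hA).card_pos
        parts_sum := hcard }
    have hP : ∑ A ∈ T, maxR (Finset.univ.filter fun k => κ k = A).card
        ((Finset.univ.filter fun k => κ k = A).card - 1) ≤ partitionMaxR r := by
      have := sum_maxR_le_partitionMaxR P
      rwa [Multiset.map_map] at this
    rw [hFG, map_sum]
    refine (waringRank_sum_le _ _).trans (le_trans ?_ (mul_le_mul_left hP _))
    rw [Finset.sum_mul]
    refine Finset.sum_le_sum fun A hA => ?_
    refine waringRank_leading_term_le hd A.rep_nonzero (hpos A hA) ?_ (fun k hk => ?_) (hGhom A)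
      (hG A)
    · exact (Finset.card_le_univ _).trans (by simpa using hr)
    · rw [← (Finset.mem_filter.1 hk).2]
      exact hκ k
  · -- in degree `d < r - 1` it is enough that the limit depends on at most `r` variables only
    have hdim := le_finrank_limitKernel L Finset.univ
    rw [Finset.card_univ, Fintype.card_fin] at hdim
    obtain ⟨ρ, g, hg, hFg⟩ := exists_eq_aeval_linForm hdim (hF.map Polynomial.constantCoeff)
      fun v hv => translate_leading_term h hv
    rw [hFg]
    have hP := sum_maxR_le_partitionMaxR (r := r)
      { parts := {r}
        parts_pos := by intro i hi; rw [Multiset.mem_singleton.1 hi]; omega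
        parts_sum := by simp }
    rw [Multiset.map_singleton, Multiset.sum_singleton] at hP
    calc waringRank d (aeval (fun j => linForm (ρ j)) g)
        ≤ maxR r d := (waringRank_aeval_le ρ g).trans (waringRank_le_maxR hg)
      _ ≤ maxR r (r - 1) := maxR_mono_right (by omega) hd (by omega)
      _ ≤ partitionMaxR r * 1 := by rwa [mul_one]
      _ ≤ partitionMaxR r * d := by gcongr; exact_mod_cast hd

theorem hasBorderDecomposition_of_borderWaringRank_eq {f : MvPolynomial (Fin n) ℂ} {r : ℕ}
    (h : borderWaringRank d f = r) : HasBorderDecomposition d f r := by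
  classical
  by_cases hex : ∃ r, HasBorderDecomposition d f r
  · have h1 : borderWaringRank d f = Nat.find hex :=
      le_antisymm (iInf₂_le _ (Nat.find_spec hex))
        (le_iInf₂ fun r hr => Nat.cast_le.2 (Nat.find_min' hex hr))
    rw [h] at h1
    rw [Nat.cast_inj.1 h1]
    exact Nat.find_spec hex
  · push Not at hex
    simp [borderWaringRank, hex] at h

end

end Waring

/-- A form `f` of degree `d ≥ 1` with border Waring rank `r` has `WR(f) ≤ M(r) · d`, where `M` is
the partition-maxrank function; the maximum defining `M(r)` is finite. -/
theorem mainTheorem2 (n d r : ℕ) (hd : 1 ≤ d) (f : MvPolynomial (Fin n) ℂ)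
    (hf : f.IsHomogeneous d) (hr : Waring.borderWaringRank d f = (r : ℕ∞)) :
    Waring.partitionMaxR r < ⊤ ∧
      Waring.waringRank d f ≤ Waring.partitionMaxR r * (d : ℕ∞) := by
  refine ⟨Waring.partitionMaxR_lt_top r, ?_⟩
  rcases Nat.eq_zero_or_pos n with rfl | hn
  · -- without variables there is no primitive vector to start from, but then `f = 0`
    have h0 : f = 0 := by
      by_contra h0
      have := (MvPolynomial.isHomogeneous_of_isEmpty _ _ f).inj_right hf h0
      omega
    rw [h0, Waring.waringRank_zero]
    exact zero_le
  · obtain ⟨c, L, m, F, hL, hF, hsum, rfl⟩ := Waring.exists_polynomial_decomposition hn hd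
      (Waring.hasBorderDecomposition_of_borderWaringRank_eq hr)
    exact Waring.waringRank_le_partitionMaxR_mul hd hL hF hsum
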